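/- Let $0<p<1$. For a function $f$ analytic in the open unit disc $\mathbb{D}=\{z\in\mathbb{C}:|z|<1\}$ put \[ \|f\|_{H^p}:=\sup_{0<r<1}\left(\int_0^{2\pi}|f(re^{i\theta})|^p\,\frac{d\theta}{2\pi}\right)^{1/p}, \] and let $H^p$ be the set of all such $f$ with $\|f\|_{H^p}<\infty$. For real $\alpha\ge 1$ let $c_\alpha(n):=\binom{n+\alpha-1}{n}=\frac{\alpha(\alpha+1)\cdots(\alpha+n-1)}{n!}$ be the coefficients of the binomial series $(1-z)^{-\alpha}=\sum_{n\ge0}c_\alpha(n)z^n$, $z\in\mathbb{D}$. Set \[ C:=\left(\frac{2}{e\log 2}\right)^{1/2}=1.030279\ldots \] Then for every $f\in H^p$ with power series $f(z)=\sum_{n=0}^\infty a_nz^n$ in $\mathbb{D}$, the series $\sum_{n=0}^\infty |a_n|^2/c_{2/p}(n)$ converges and \[ \left(\sum_{n=0}^\infty\frac{|a_n|^2}{c_{2/p}(n)}\right)^{1/2}\le C\,\|f\|_{H^p}. \] -/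

import Mathlib

open scoped ENNReal

noncomputable section

/-- The coefficient `c_α(n) = binom (n + α - 1) n` of the binomial series of `(1 - z) ^ (-α)`,
where `Ring.choose x n = x (x - 1) ⋯ (x - n + 1) / n!` for real `x`. -/
def binomCoeff (α : ℝ) (n : ℕ) : ℝ :=
  Ring.choose ((n : ℝ) + α - 1) n

/-- The binomial coefficients are the Taylor coefficients of `(1 - z) ^ (-α)` in the unit disc. -/
theorem hasSum_binomCoeff (α : ℝ) {z : ℂ} (hz : z ∈ Metric.ball (0 : ℂ) 1) :
    HasSum (fun n : ℕ => (binomCoeff α n : ℂ) * z ^ n) (1 / (1 - z) ^ (α : ℂ)) := by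
  have h := (Complex.one_div_one_sub_cpow_hasFPowerSeriesOnBall_zero (α : ℂ)).hasSum
    (y := z) (by simpa [← ofReal_norm] using hz)
  have hc : ∀ n : ℕ, (binomCoeff α n : ℂ) = Ring.choose ((α : ℂ) + n - 1) n := by
    intro n
    have := Ring.map_choose Complex.ofRealHom ((n : ℝ) + α - 1) n
    simp only [Complex.ofRealHom_eq_coe, map_sub, map_add, map_one, map_natCast] at this
    rw [binomCoeff, this, add_comm (n : ℂ)]
  simpa [FormalMultilinearSeries.ofScalars_apply_eq, hc, mul_comm] using h

/-- The Hardy (quasi-)norm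
`‖f‖_{H^p} = sup_{0 < r < 1} (∫_0^{2π} |f (r e^{iθ})| ^ p dθ / (2π)) ^ (1 / p)`,
with values in `[0, ∞]`. -/
def hardyNorm (p : ℝ) (f : ℂ → ℂ) : ℝ≥0∞ :=
  ⨆ r ∈ Set.Ioo (0 : ℝ) 1,
    ((∫⁻ θ in Set.Ioc (0 : ℝ) (2 * Real.pi),
        ‖f ((r : ℂ) * Complex.exp ((θ : ℂ) * Complex.I))‖ₑ ^ p) /
      ENNReal.ofReal (2 * Real.pi)) ^ (1 / p)

/-- `f` belongs to the Hardy space `H^p` of the open unit disc: it is analytic there and its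
Hardy (quasi-)norm is finite. Values of `f` outside the disc play no role. -/
def MemHardy (p : ℝ) (f : ℂ → ℂ) : Prop :=
  DifferentiableOn ℂ f (Metric.ball (0 : ℂ) 1) ∧ hardyNorm p f < ∞

end

/-!
Put `α = 2 / p > 2`. By Parseval's identity in each circle and the beta integral,
`∑ |a n|² / c_α(n)` is the weighted area integral
`(α - 1) ∫₀¹ (1 - t) ^ (α - 2) ∫ |f (√t e^{iθ})|² dθ / (2π) dt`
(`HasSumOnDisc.bergmanIntegral_two`), which can only grow when `|f|` grows in the disc.

For a polynomial `P`, reflecting the zeros in the unit circle (`Polynomial.exists_reflect_roots`)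
therefore reduces the claim to a polynomial `Q` without zeros in the disc. Such a `Q` has a
holomorphic logarithm, hence a holomorphic branch `g` of `Q ^ (1 / α)`, and the squared `H²` norm of
`g` is at most the mean `A` of `|Q| ^ p` over the unit circle. If `α` is replaced by an integer
`k ≥ 2`, the area integral of `|g| ^ (2 k)` is computed by the coefficients of `g ^ k`, and
Cauchy–Schwarz (`tsum_enorm_sq_coeff_pow_le`) bounds it by `A ^ k / (k - 1)`; this is Carleman's
argument. Hölder's inequality interpolates between the integers `k = m + 1` and `k + 1` on either
side of `α = k + s`, at the cost of the factor `(m + s) / (m ^ (1 - s) (m + 1) ^ s)`. It is largest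
for `m = 1`, where the maximum of `(1 + s) / 2 ^ s` is `2 / (e log 2)` (`interpolation_const_le`).

A general `f` in `H^p` is reached by applying this to the Taylor polynomials of `f (r z)` and letting
first their degree tend to infinity and then `r` to `1`.
-/

open MeasureTheory Filter Topology Polynomial
open Finset.HasAntidiagonal (antidiagonal)

/-! ### Binomial coefficients and the beta integral -/

theorem binomCoeff_eq_multichoose (α : ℝ) (n : ℕ) : binomCoeff α n = Ring.multichoose α n := by
  rw [Ring.multichoose_eq, binomCoeff, add_comm (n : ℝ)]

theorem binomCoeff_eq_ascPochhammer (α : ℝ) (n : ℕ) :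
    binomCoeff α n = (ascPochhammer ℝ n).eval α / n.factorial := by
  have h := Ring.factorial_nsmul_multichoose_eq_ascPochhammer α n
  rw [← binomCoeff_eq_multichoose, nsmul_eq_mul, Polynomial.ascPochhammer_smeval_eq_eval] at h
  rw [← h, mul_div_cancel_left₀ _ (by positivity)]

theorem binomCoeff_pos {α : ℝ} (hα : 0 < α) (n : ℕ) : 0 < binomCoeff α n := by
  rw [binomCoeff_eq_ascPochhammer]
  have := ascPochhammer_pos n α hα
  positivity

theorem binomCoeff_natCast (k n : ℕ) : binomCoeff k n = Nat.multichoose k n := by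
  rcases k with _ | k
  · rcases n with _ | n <;> simp [binomCoeff_eq_ascPochhammer]
  · rw [binomCoeff, Nat.multichoose_eq, ← Ring.choose_natCast]
    congr 1
    have : k + 1 + n - 1 = n + k := by omega
    rw [this]
    push_cast
    ring

theorem Real.Gamma_add_natCast_eq {α : ℝ} (hα : 0 < α) (n : ℕ) :
    Real.Gamma (α + n) = (ascPochhammer ℝ n).eval α * Real.Gamma α := by
  induction n with
  | zero => simp
  | succ n ih =>
    rw [Nat.cast_succ, ← add_assoc, Real.Gamma_add_one (by positivity), ih,
      ascPochhammer_succ_right]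
    simp
    ring

/-- The beta integral `B(n + 1, α - 1)` is the reciprocal of `(α - 1) c_α(n)`. -/
theorem beta_natCast_add_one {α : ℝ} (hα : 1 < α) (n : ℕ) :
    ProbabilityTheory.beta (n + 1) (α - 1) = 1 / ((α - 1) * binomCoeff α n) := by
  have h1 : Real.Gamma α = (α - 1) * Real.Gamma (α - 1) := by
    rw [← Real.Gamma_add_one (by linarith)]; congr 1; ring
  have h2 := Real.Gamma_add_natCast_eq (by linarith : 0 < α) n
  have h3 : (n : ℝ) + 1 + (α - 1) = α + n := by ring
  have h4 := ascPochhammer_pos n α (by linarith)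
  have h5 := Real.Gamma_pos_of_pos (by linarith : 0 < α - 1)
  have h6 : 0 < α - 1 := by linarith
  rw [ProbabilityTheory.beta, h3, h2, h1, Real.Gamma_nat_eq_factorial, binomCoeff_eq_ascPochhammer]
  field_simp

theorem lintegral_pow_mul_one_sub_rpow {α : ℝ} (hα : 1 < α) (n : ℕ) :
    ∫⁻ t in Set.Ioo (0 : ℝ) 1, ENNReal.ofReal ((1 - t) ^ (α - 2)) * ENNReal.ofReal t ^ n =
      (ENNReal.ofReal ((α - 1) * binomCoeff α n))⁻¹ := by
  have hn : (0 : ℝ) < n + 1 := by positivity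
  have hα' : 0 < α - 1 := by linarith
  have hb := ProbabilityTheory.beta_pos hn hα'
  have h := ProbabilityTheory.lintegral_betaPDF_eq_one hn hα'
  rw [ProbabilityTheory.lintegral_betaPDF] at h
  have h2 : ∫⁻ t in Set.Ioo (0 : ℝ) 1,
      ENNReal.ofReal ((1 - t) ^ (α - 2)) * ENNReal.ofReal t ^ n =
      ENNReal.ofReal (ProbabilityTheory.beta (n + 1) (α - 1)) * ∫⁻ t in Set.Ioo (0 : ℝ) 1,
        ENNReal.ofReal (1 / ProbabilityTheory.beta (n + 1) (α - 1) * t ^ ((n : ℝ) + 1 - 1) *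
          (1 - t) ^ (α - 1 - 1)) := by
    rw [← lintegral_const_mul' _ _ ENNReal.ofReal_ne_top]
    refine setLIntegral_congr_fun measurableSet_Ioo fun t ht => ?_
    have ht1 : 0 < 1 - t := by linarith [ht.2]
    rw [← ENNReal.ofReal_pow ht.1.le, ← ENNReal.ofReal_mul (by positivity),
      ← ENNReal.ofReal_mul hb.le]
    congr 1
    rw [add_sub_cancel_right, Real.rpow_natCast, show α - 1 - 1 = α - 2 by ring]
    field_simp
  rw [h2, h, mul_one, beta_natCast_add_one hα, one_div, ENNReal.ofReal_inv_of_pos]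
  exact mul_pos hα' (binomCoeff_pos (by linarith) n)

/-! ### The coefficients of powers of a power series -/

/-- The coefficients of `(1 - z) ^ (-(k + 1))` are the partial sums of those of `(1 - z) ^ (-k)`. -/
theorem sum_antidiagonal_multichoose (k n : ℕ) :
    ∑ x ∈ antidiagonal n, Nat.multichoose k x.1 = Nat.multichoose (k + 1) n := by
  rw [Finset.Nat.sum_antidiagonal_eq_sum_range_succ_mk]
  induction n with
  | zero => simp
  | succ n ih => rw [Finset.sum_range_succ, ih, Nat.multichoose_succ_succ, add_comm]

theorem ENNReal.tsum_mul_tsum_eq_tsum_sum_antidiagonal (u v : ℕ → ℝ≥0∞) :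
    (∑' n, u n) * ∑' n, v n = ∑' n, ∑ x ∈ antidiagonal n, u x.1 * v x.2 := by
  rw [← ENNReal.tsum_mul_right]
  simp_rw [← ENNReal.tsum_mul_left]
  rw [← ENNReal.tsum_prod (f := fun i j => u i * v j),
    ← Finset.HasAntidiagonal.sigmaAntidiagonalEquivProd.tsum_eq (fun x : ℕ × ℕ => u x.1 * v x.2),
    ENNReal.tsum_sigma']
  refine tsum_congr fun n => ?_
  rw [tsum_fintype]
  exact Finset.sum_coe_sort (antidiagonal n) (fun x : ℕ × ℕ => u x.1 * v x.2)

theorem enorm_sq_div_natCast (z : ℂ) {c : ℕ} (hc : 0 < c) :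
    ‖z‖ₑ ^ 2 / (c : ℝ≥0∞) = ENNReal.ofReal (‖z‖ ^ 2 / c) := by
  rw [ENNReal.ofReal_div_of_pos (by exact_mod_cast hc), ENNReal.ofReal_pow (norm_nonneg _),
    ofReal_norm, ENNReal.ofReal_natCast]

/-- Weighted Cauchy–Schwarz for one coefficient of a product of power series: the weights
`c_k(0), …, c_k(n)` add up to `c_{k + 1}(n)`. -/
theorem enorm_sq_coeff_mul_le (F B : PowerSeries ℂ) {k : ℕ} (hk : 0 < k) (n : ℕ) :
    ‖(F * B).coeff n‖ₑ ^ 2 / (Nat.multichoose (k + 1) n : ℝ≥0∞) ≤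
      ∑ x ∈ antidiagonal n,
        ‖F.coeff x.1‖ₑ ^ 2 / (Nat.multichoose k x.1 : ℝ≥0∞) * ‖B.coeff x.2‖ₑ ^ 2 := by
  have hpos : ∀ (k n : ℕ), 0 < k → 0 < Nat.multichoose k n := fun k n hk => by
    have := binomCoeff_pos (α := k) (by exact_mod_cast hk) n
    rw [binomCoeff_natCast] at this
    exact_mod_cast this
  have hc : (0 : ℝ) < Nat.multichoose (k + 1) n := by exact_mod_cast hpos _ n (Nat.succ_pos k)
  have hr : ‖(F * B).coeff n‖ ^ 2 / (Nat.multichoose (k + 1) n : ℝ) ≤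
      ∑ x ∈ antidiagonal n,
        ‖F.coeff x.1‖ ^ 2 / (Nat.multichoose k x.1 : ℝ) * ‖B.coeff x.2‖ ^ 2 := by
    rw [div_le_iff₀' hc, ← sum_antidiagonal_multichoose, Nat.cast_sum, PowerSeries.coeff_mul]
    calc ‖∑ x ∈ antidiagonal n, F.coeff x.1 * B.coeff x.2‖ ^ 2
        ≤ (∑ x ∈ antidiagonal n, ‖F.coeff x.1 * B.coeff x.2‖) ^ 2 := by
          gcongr; exact norm_sum_le _ _
      _ ≤ _ := by
          refine Finset.sum_sq_le_sum_mul_sum_of_sq_le_mul _ (fun _ _ => by positivity)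
            (fun _ _ => by positivity) fun x _ => ?_
          have : (0 : ℝ) < Nat.multichoose k x.1 := by exact_mod_cast hpos _ x.1 hk
          refine le_of_eq ?_
          rw [norm_mul]
          field_simp
  rw [enorm_sq_div_natCast _ (hpos _ _ (Nat.succ_pos k))]
  refine (ENNReal.ofReal_le_ofReal hr).trans_eq ?_
  rw [ENNReal.ofReal_sum_of_nonneg (fun _ _ => by positivity)]
  refine Finset.sum_congr rfl fun x _ => ?_
  rw [ENNReal.ofReal_mul (by positivity), ENNReal.ofReal_pow (norm_nonneg _), ofReal_norm,
    enorm_sq_div_natCast _ (hpos _ _ hk)]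

/-- Carleman's inequality for integer powers, in terms of coefficients. -/
theorem tsum_enorm_sq_coeff_pow_le (B : PowerSeries ℂ) (k : ℕ) :
    ∑' n, ‖(B ^ (k + 1)).coeff n‖ₑ ^ 2 / (Nat.multichoose (k + 1) n : ℝ≥0∞) ≤
      (∑' n, ‖B.coeff n‖ₑ ^ 2) ^ (k + 1) := by
  induction k with
  | zero => simp
  | succ k ih =>
    calc _ ≤ ∑' n, ∑ x ∈ antidiagonal n,
          ‖(B ^ (k + 1)).coeff x.1‖ₑ ^ 2 / (Nat.multichoose (k + 1) x.1 : ℝ≥0∞) *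
            ‖B.coeff x.2‖ₑ ^ 2 := by
          refine ENNReal.tsum_le_tsum fun n => ?_
          rw [pow_succ B]
          exact enorm_sq_coeff_mul_le _ _ (Nat.succ_pos k) n
      _ = (∑' n, ‖(B ^ (k + 1)).coeff n‖ₑ ^ 2 / (Nat.multichoose (k + 1) n : ℝ≥0∞)) *
          ∑' n, ‖B.coeff n‖ₑ ^ 2 :=
        (ENNReal.tsum_mul_tsum_eq_tsum_sum_antidiagonal
          (fun n => ‖(B ^ (k + 1)).coeff n‖ₑ ^ 2 / (Nat.multichoose (k + 1) n : ℝ≥0∞))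
          (fun n => ‖B.coeff n‖ₑ ^ 2)).symm
      _ ≤ _ := by rw [pow_succ _ (k + 1)]; gcongr

/-- The power series `B` converges to the function `g` at every point of the open unit disc. -/
def HasSumOnDisc (B : PowerSeries ℂ) (g : ℂ → ℂ) : Prop :=
  ∀ z ∈ Metric.ball (0 : ℂ) 1, HasSum (fun n => B.coeff n * z ^ n) (g z)

theorem HasSumOnDisc.mul {B D : PowerSeries ℂ} {g h : ℂ → ℂ} (hB : HasSumOnDisc B g)
    (hD : HasSumOnDisc D h) : HasSumOnDisc (B * D) (fun z => g z * h z) := by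
  intro z hz
  have h1 := (hB z hz).summable.norm
  have h2 := (hD z hz).summable.norm
  have h3 := tsum_mul_tsum_eq_tsum_sum_antidiagonal_of_summable_norm h1 h2
  have h4 := (summable_norm_sum_mul_antidiagonal_of_summable_norm h1 h2).of_norm.hasSum
  rw [← h3, (hB z hz).tsum_eq, (hD z hz).tsum_eq] at h4
  convert! h4 using 2 with n
  rw [PowerSeries.coeff_mul, Finset.sum_mul]
  refine Finset.sum_congr rfl fun x hx => ?_
  rw [← Finset.HasAntidiagonal.mem_antidiagonal.mp hx, pow_add]
  ring

theorem HasSumOnDisc.pow {B : PowerSeries ℂ} {g : ℂ → ℂ} (hB : HasSumOnDisc B g) (k : ℕ) :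
    HasSumOnDisc (B ^ k) (fun z => g z ^ k) := by
  induction k with
  | zero =>
    intro z _
    have h := hasSum_ite_eq (0 : ℕ) (1 : ℂ)
    convert! h using 2 with n
    rcases n with _ | n <;> simp [PowerSeries.coeff_one]
  | succ k ih => simpa only [pow_succ] using ih.mul hB

theorem DifferentiableOn.exists_hasSumOnDisc {g : ℂ → ℂ}
    (hg : DifferentiableOn ℂ g (Metric.ball 0 1)) : ∃ B, HasSumOnDisc B g := by
  refine ⟨PowerSeries.mk fun n => (n.factorial : ℂ)⁻¹ * iteratedDeriv n g 0, fun z hz => ?_⟩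
  have := Complex.hasSum_taylorSeries_on_ball hg hz
  simpa [mul_comm, mul_left_comm, mul_assoc] using this

/-! ### Means over circles -/

/-- Normalized Lebesgue measure on `(0, 2π]`, the parameter interval of the circle. -/
noncomputable def circleMeasure : Measure ℝ :=
  (ENNReal.ofReal (2 * Real.pi))⁻¹ • volume.restrict (Set.Ioc 0 (2 * Real.pi))

theorem lintegral_circleMeasure (F : ℝ → ℝ≥0∞) :
    ∫⁻ θ, F θ ∂circleMeasure =
      (∫⁻ θ in Set.Ioc (0 : ℝ) (2 * Real.pi), F θ) / ENNReal.ofReal (2 * Real.pi) := by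
  rw [circleMeasure, lintegral_smul_measure, smul_eq_mul, ENNReal.div_eq_inv_mul]

instance : IsProbabilityMeasure circleMeasure where
  measure_univ := by
    have : ENNReal.ofReal (2 * Real.pi) ≠ 0 := by simp [Real.pi_pos]
    simp only [circleMeasure, Measure.smul_apply, Measure.restrict_apply_univ, Real.volume_Ioc,
      sub_zero, smul_eq_mul]
    exact ENNReal.inv_mul_cancel this ENNReal.ofReal_ne_top

theorem norm_circleMap_zero_of_nonneg {r : ℝ} (hr : 0 ≤ r) (θ : ℝ) : ‖circleMap 0 r θ‖ = r := by
  simp [abs_of_nonneg hr]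

/-- Bounded convergence for power means. -/
theorem tendsto_lintegral_enorm_rpow {ι : Type*} {l : Filter ι} [l.IsCountablyGenerated]
    {μ : Measure ℝ} [IsFiniteMeasure μ] {F : ι → ℝ → ℂ} {G : ℝ → ℂ} {q M : ℝ} (hq : 0 < q)
    (hF : ∀ᶠ i in l, Continuous (F i)) (hM : ∀ᶠ i in l, ∀ θ, ‖F i θ‖ ≤ M)
    (hG : ∀ θ, Tendsto (fun i => F i θ) l (𝓝 (G θ))) :
    Tendsto (fun i => ∫⁻ θ, ‖F i θ‖ₑ ^ q ∂μ) l (𝓝 (∫⁻ θ, ‖G θ‖ₑ ^ q ∂μ)) := by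
  refine tendsto_lintegral_filter_of_dominated_convergence (fun _ => ENNReal.ofReal M ^ q) ?_ ?_ ?_ ?_
  · filter_upwards [hF] with i hi
    exact (ENNReal.continuous_rpow_const.comp hi.enorm).measurable
  · filter_upwards [hM] with i hi
    refine Eventually.of_forall fun θ => ?_
    gcongr
    rw [← ofReal_norm]
    exact ENNReal.ofReal_le_ofReal (hi θ)
  · rw [lintegral_const]
    exact ENNReal.mul_ne_top (ENNReal.rpow_ne_top_of_nonneg hq.le ENNReal.ofReal_ne_top)
      (measure_ne_top _ _)
  · refine Eventually.of_forall fun θ => ?_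
    exact (ENNReal.continuous_rpow_const.tendsto _).comp ((continuous_enorm.tendsto _).comp (hG θ))

theorem Polynomial.lintegral_enorm_sq_circle (P : ℂ[X]) :
    ∫⁻ θ, ‖P.eval (circleMap 0 1 θ)‖ₑ ^ 2 ∂circleMeasure = ∑ n ∈ P.support, ‖P.coeff n‖ₑ ^ 2 := by
  have hc : Continuous fun θ => ‖P.eval (circleMap 0 1 θ)‖ ^ 2 :=
    ((P.continuous.comp (continuous_circleMap 0 1)).norm).pow 2
  have h := P.sum_sq_norm_coeff_eq_circleAverage
  rw [Real.circleAverage, intervalIntegral.integral_of_le Real.two_pi_pos.le, smul_eq_mul] at h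
  have e : ∀ z : ℂ, ‖z‖ₑ ^ 2 = ENNReal.ofReal (‖z‖ ^ 2) := fun z => by
    rw [ENNReal.ofReal_pow (norm_nonneg _), ofReal_norm]
  simp_rw [e]
  rw [← ENNReal.ofReal_sum_of_nonneg (fun _ _ => by positivity), h,
    ENNReal.ofReal_mul (inv_nonneg.mpr Real.two_pi_pos.le),
    ENNReal.ofReal_inv_of_pos Real.two_pi_pos, ofReal_integral_eq_lintegral_ofReal,
    lintegral_circleMeasure, ENNReal.div_eq_inv_mul]
  · exact (hc.integrableOn_Icc (μ := volume)).mono_set Set.Ioc_subset_Icc_self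
  · exact Eventually.of_forall fun θ => by positivity

/-- The Taylor polynomial of degree less than `N` of the dilation `z ↦ g (r z)`, where `B` is the
power series of `g`. -/
noncomputable def dilatedTrunc (B : PowerSeries ℂ) (r : ℝ) (N : ℕ) : ℂ[X] :=
  PowerSeries.trunc N (PowerSeries.rescale (r : ℂ) B)

theorem coeff_dilatedTrunc (B : PowerSeries ℂ) (r : ℝ) (N n : ℕ) :
    (dilatedTrunc B r N).coeff n = if n < N then (r : ℂ) ^ n * B.coeff n else 0 := by
  simp [dilatedTrunc, PowerSeries.coeff_trunc]

theorem eval_dilatedTrunc (B : PowerSeries ℂ) (r : ℝ) (N : ℕ) (θ : ℝ) :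
    (dilatedTrunc B r N).eval (circleMap 0 1 θ) =
      ∑ n ∈ Finset.range N, B.coeff n * circleMap 0 r θ ^ n := by
  rw [dilatedTrunc, Polynomial.eval, PowerSeries.eval₂_trunc_eq_sum_range]
  refine Finset.sum_congr rfl fun n _ => ?_
  simp [circleMap]
  ring

theorem HasSumOnDisc.tendsto_lintegral_dilatedTrunc {B : PowerSeries ℂ} {g : ℂ → ℂ}
    (h : HasSumOnDisc B g) {r : ℝ} (hr0 : 0 ≤ r) (hr1 : r < 1) {q : ℝ} (hq : 0 < q) :
    Tendsto (fun N => ∫⁻ θ, ‖(dilatedTrunc B r N).eval (circleMap 0 1 θ)‖ₑ ^ q ∂circleMeasure)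
      atTop (𝓝 (∫⁻ θ, ‖g (circleMap 0 r θ)‖ₑ ^ q ∂circleMeasure)) := by
  have hmem : ∀ θ, circleMap 0 r θ ∈ Metric.ball (0 : ℂ) 1 := fun θ => by
    rwa [mem_ball_zero_iff, norm_circleMap_zero_of_nonneg hr0]
  have hs := (h _ (hmem 0)).summable.norm
  refine tendsto_lintegral_enorm_rpow (M := ∑' n, ‖B.coeff n * circleMap 0 r 0 ^ n‖) hq ?_ ?_ ?_
  · exact Eventually.of_forall fun N =>
      (dilatedTrunc B r N).continuous.comp (continuous_circleMap 0 1)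
  · refine Eventually.of_forall fun N θ => ?_
    rw [eval_dilatedTrunc]
    refine (norm_sum_le _ _).trans (le_trans (le_of_eq ?_) (hs.sum_le_tsum (Finset.range N)
      fun _ _ => norm_nonneg _))
    refine Finset.sum_congr rfl fun n _ => ?_
    rw [norm_mul, norm_mul, norm_pow, norm_pow, norm_circleMap_zero_of_nonneg hr0,
      norm_circleMap_zero_of_nonneg hr0]
  · intro θ
    simp_rw [eval_dilatedTrunc]
    exact (h _ (hmem θ)).tendsto_sum_nat

/-- Parseval's identity on the circle of radius `r < 1`. -/
theorem HasSumOnDisc.lintegral_enorm_sq {B : PowerSeries ℂ} {g : ℂ → ℂ}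
    (h : HasSumOnDisc B g) {r : ℝ} (hr0 : 0 ≤ r) (hr1 : r < 1) :
    ∫⁻ θ, ‖g (circleMap 0 r θ)‖ₑ ^ 2 ∂circleMeasure =
      ∑' n, ‖B.coeff n‖ₑ ^ 2 * ENNReal.ofReal (r ^ 2) ^ n := by
  have h1 := h.tendsto_lintegral_dilatedTrunc hr0 hr1 (q := 2) (by norm_num)
  simp_rw [ENNReal.rpow_two] at h1
  refine tendsto_nhds_unique h1 ?_
  have h2 := ENNReal.tendsto_nat_tsum fun n => ‖B.coeff n‖ₑ ^ 2 * ENNReal.ofReal (r ^ 2) ^ n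
  refine h2.congr fun N => ?_
  rw [Polynomial.lintegral_enorm_sq_circle]
  have hsub : (dilatedTrunc B r N).support ⊆ Finset.range N := fun n hn => by
    by_contra hN
    rw [Polynomial.mem_support_iff, coeff_dilatedTrunc, if_neg (by simpa using hN)] at hn
    exact hn rfl
  rw [Finset.sum_subset hsub fun n _ hn => by simp [Polynomial.notMem_support_iff.mp hn]]
  refine Finset.sum_congr rfl fun n hn => ?_
  rw [coeff_dilatedTrunc, if_pos (Finset.mem_range.mp hn), enorm_mul, enorm_pow, mul_pow,
    mul_comm, ← pow_mul, mul_comm n 2, pow_mul]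
  congr 3
  rw [← ofReal_norm, Complex.norm_real, Real.norm_of_nonneg hr0, ENNReal.ofReal_pow hr0]

/-! ### Weighted Bergman norms -/

/-- The weighted area integral
`∫₀¹ (1 - t) ^ (β - 2) ∫ ‖F (√t e^{iθ})‖ ^ q dθ / (2π) dt`; the substitution `t = |z|²` turns it
into `∫ |F| ^ q (1 - |z|²) ^ (β - 2) dA / π` over the disc. -/
noncomputable def bergmanIntegral (β q : ℝ) (F : ℂ → ℂ) : ℝ≥0∞ :=
  ∫⁻ t in Set.Ioo (0 : ℝ) 1, ENNReal.ofReal ((1 - t) ^ (β - 2)) *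
    ∫⁻ θ, ‖F (circleMap 0 (√t) θ)‖ₑ ^ q ∂circleMeasure

theorem bergmanIntegral_mono {β q : ℝ} (hq : 0 ≤ q) {F G : ℂ → ℂ}
    (h : ∀ z ∈ Metric.ball (0 : ℂ) 1, ‖F z‖ ≤ ‖G z‖) :
    bergmanIntegral β q F ≤ bergmanIntegral β q G := by
  refine setLIntegral_mono' measurableSet_Ioo fun t ht => ?_
  gcongr with θ
  rw [enorm_le_iff_norm_le]
  refine h _ ?_
  rw [mem_ball_zero_iff, norm_circleMap_zero_of_nonneg (Real.sqrt_nonneg _), Real.sqrt_lt' one_pos]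
  simpa using ht.2

/-- Integrating Parseval's identity over the radius: the weighted Bergman norm in terms of the Taylor
coefficients. -/
theorem HasSumOnDisc.bergmanIntegral_two {B : PowerSeries ℂ} {g : ℂ → ℂ} (h : HasSumOnDisc B g)
    {α : ℝ} (hα : 1 < α) :
    ENNReal.ofReal (α - 1) * bergmanIntegral α 2 g =
      ∑' n, ‖B.coeff n‖ₑ ^ 2 / ENNReal.ofReal (binomCoeff α n) := by
  have h1 : bergmanIntegral α 2 g = ∫⁻ t in Set.Ioo (0 : ℝ) 1, ∑' n,
      ‖B.coeff n‖ₑ ^ 2 * (ENNReal.ofReal ((1 - t) ^ (α - 2)) * ENNReal.ofReal t ^ n) := by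
    refine setLIntegral_congr_fun measurableSet_Ioo fun t ht => ?_
    have := h.lintegral_enorm_sq (Real.sqrt_nonneg t)
      (by rw [Real.sqrt_lt' one_pos]; simpa using ht.2)
    simp_rw [ENNReal.rpow_two, this, Real.sq_sqrt ht.1.le]
    rw [← ENNReal.tsum_mul_left]
    exact tsum_congr fun n => by ring
  have hα' : 0 < α - 1 := by linarith
  rw [h1, lintegral_tsum fun n => by fun_prop, ← ENNReal.tsum_mul_left]
  refine tsum_congr fun n => ?_
  have hc := binomCoeff_pos (by linarith : 0 < α) n
  rw [lintegral_const_mul' _ _ (by simp), lintegral_pow_mul_one_sub_rpow hα,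
    ENNReal.ofReal_mul hα'.le, ENNReal.mul_inv (by simp) (by simp), div_eq_mul_inv,
    mul_left_comm, ← mul_assoc (ENNReal.ofReal (α - 1)), ENNReal.mul_inv_cancel (by simp [hα])
    (by simp), one_mul]

/-! ### Reflection of zeros -/

/-- Replacing the factor `z - w` by `1 - conj w z` for each zero `w` of `P` in the disc gives a
polynomial without zeros in the disc, of the same modulus on the unit circle and of no smaller
modulus inside. This amounts to dividing `P` by a finite Blaschke product. -/
theorem Polynomial.exists_reflect_roots (P : ℂ[X]) (hP : P ≠ 0) :
    ∃ Q : ℂ[X], (∀ z ∈ Metric.ball (0 : ℂ) 1, Q.eval z ≠ 0) ∧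
      (∀ z ∈ Metric.ball (0 : ℂ) 1, ‖P.eval z‖ ≤ ‖Q.eval z‖) ∧
      ∀ z : ℂ, ‖z‖ = 1 → ‖P.eval z‖ = ‖Q.eval z‖ := by
  have key : ∀ s : Multiset ℂ, ∃ Q : ℂ[X], (∀ z ∈ Metric.ball (0 : ℂ) 1, Q.eval z ≠ 0) ∧
      (∀ z ∈ Metric.ball (0 : ℂ) 1,
        ‖((s.map fun w => X - C w).prod).eval z‖ ≤ ‖Q.eval z‖) ∧
      ∀ z : ℂ, ‖z‖ = 1 → ‖((s.map fun w => X - C w).prod).eval z‖ = ‖Q.eval z‖ := by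
    intro s
    induction s using Multiset.induction_on with
    | empty => exact ⟨1, by simp⟩
    | cons w s ih =>
      obtain ⟨Q, h0, h1, h2⟩ := ih
      -- `|1 - conj w z|² - |z - w|² = (1 - |z|²)(1 - |w|²)`
      have hid : ∀ z : ℂ, ‖1 - (starRingEnd ℂ) w * z‖ ^ 2 - ‖z - w‖ ^ 2 =
          (1 - ‖z‖ ^ 2) * (1 - ‖w‖ ^ 2) := fun z => by
        simp only [Complex.sq_norm, Complex.normSq_apply, Complex.sub_re, Complex.sub_im,
          Complex.mul_re, Complex.mul_im, Complex.conj_re, Complex.conj_im, Complex.one_re,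
          Complex.one_im]
        ring
      by_cases hw : ‖w‖ < 1
      · refine ⟨(1 - C ((starRingEnd ℂ) w) * X) * Q, fun z hz => ?_, fun z hz => ?_, fun z hz => ?_⟩
        · rw [mem_ball_zero_iff] at hz
          have h3 := hid z
          have : 0 < (1 - ‖z‖ ^ 2) * (1 - ‖w‖ ^ 2) := by
            have := norm_nonneg z
            have := norm_nonneg w
            apply mul_pos <;> nlinarith
          have h4 : 1 - (starRingEnd ℂ) w * z ≠ 0 := fun h => by
            rw [h] at h3
            have := sq_nonneg ‖z - w‖
            simp only [norm_zero] at h3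
            linarith
          simpa using ⟨h4, h0 z (by simpa using hz)⟩
        · have h5 := h1 z hz
          rw [mem_ball_zero_iff] at hz
          have h3 := hid z
          have : 0 < (1 - ‖z‖ ^ 2) * (1 - ‖w‖ ^ 2) := by
            have := norm_nonneg z
            have := norm_nonneg w
            apply mul_pos <;> nlinarith
          have h4 : ‖z - w‖ ≤ ‖1 - (starRingEnd ℂ) w * z‖ :=
            le_of_sq_le_sq (by linarith) (norm_nonneg _)
          simp only [Multiset.map_cons, Multiset.prod_cons, eval_mul, norm_mul]
          simp only [eval_sub, eval_X, eval_C, eval_one, eval_mul]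
          gcongr
        · have h3 := hid z
          have h4 : ‖z - w‖ = ‖1 - (starRingEnd ℂ) w * z‖ := by
            rw [hz] at h3
            refine (sq_eq_sq₀ (norm_nonneg _) (norm_nonneg _)).mp (by linarith)
          simp only [Multiset.map_cons, Multiset.prod_cons, eval_mul, norm_mul, h2 z hz]
          simp only [eval_sub, eval_X, eval_C, eval_one, eval_mul, h4]
      · refine ⟨(X - C w) * Q, fun z hz => ?_, fun z hz => ?_, fun z hz => ?_⟩
        · have : z - w ≠ 0 := fun h => hw (by
            rw [← sub_eq_zero.mp h]; simpa using hz)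
          simpa using ⟨this, h0 z hz⟩
        · simp only [Multiset.map_cons, Multiset.prod_cons, eval_mul, norm_mul]
          gcongr
          exact h1 z hz
        · simp only [Multiset.map_cons, Multiset.prod_cons, eval_mul, norm_mul, h2 z hz]
  obtain ⟨Q, h0, h1, h2⟩ := key P.roots
  have hP' : ∀ z, P.eval z =
      P.leadingCoeff * ((P.roots.map fun w => X - C w).prod).eval z := fun z => by
    conv_lhs => rw [(IsAlgClosed.splits P).eq_prod_roots]
    rw [eval_mul, eval_C]
  refine ⟨C P.leadingCoeff * Q, fun z hz => ?_, fun z hz => ?_, fun z hz => ?_⟩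
  · simpa using ⟨hP, h0 z hz⟩
  · rw [hP', eval_mul, eval_C, norm_mul, norm_mul]
    gcongr
    exact h1 z hz
  · rw [hP', eval_mul, eval_C, norm_mul, norm_mul, h2 z hz]

/-! ### Integer exponents -/

/-- Letting the radius of dilation tend to `1` in a bound for `∑ c n * r ^ (2 * n)`. -/
theorem ENNReal.tsum_le_of_tendsto_dilations {c : ℕ → ℝ≥0∞} (hc : ∀ n, c n ≠ ∞) {X : ℝ → ℝ≥0∞}
    {Y : ℝ≥0∞} (hX : Tendsto X (𝓝[<] 1) (𝓝 Y))
    (h : ∀ r ∈ Set.Ioo (0 : ℝ) 1, ∑' n, c n * ENNReal.ofReal (r ^ 2) ^ n ≤ X r) :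
    ∑' n, c n ≤ Y := by
  refine ENNReal.tsum_le_of_sum_range_le fun N => ?_
  have hev : ∀ᶠ r : ℝ in 𝓝[<] 1, r ∈ Set.Ioo (0 : ℝ) 1 := Ioo_mem_nhdsLT one_pos
  have hl : Tendsto (fun r : ℝ => ∑ n ∈ Finset.range N, c n * ENNReal.ofReal (r ^ 2) ^ n) (𝓝[<] 1)
      (𝓝 (∑ n ∈ Finset.range N, c n)) := by
    refine tendsto_finsetSum _ fun n _ => ?_
    have h1 : Tendsto (fun r : ℝ => ENNReal.ofReal (r ^ 2) ^ n) (𝓝[<] 1) (𝓝 1) := by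
      have : Continuous fun r : ℝ => ENNReal.ofReal (r ^ 2) ^ n :=
        (ENNReal.continuous_pow n).comp (ENNReal.continuous_ofReal.comp (continuous_pow 2))
      simpa using (this.tendsto 1).mono_left nhdsWithin_le_nhds
    simpa using ENNReal.Tendsto.const_mul h1 (Or.inr (hc n))
  refine le_of_tendsto_of_tendsto hl hX ?_
  filter_upwards [hev] with r hr
  exact (ENNReal.sum_le_tsum _).trans (h r hr)

/-- A zero-free holomorphic function in the disc has a holomorphic logarithm. -/
theorem exists_exp_eq_of_differentiableOn {F : ℂ → ℂ} (hF : DifferentiableOn ℂ F (Metric.ball 0 1))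
    (h0 : ∀ z ∈ Metric.ball (0 : ℂ) 1, F z ≠ 0) :
    ∃ H : ℂ → ℂ, DifferentiableOn ℂ H (Metric.ball 0 1) ∧
      ∀ z ∈ Metric.ball (0 : ℂ) 1, Complex.exp (H z) = F z := by
  have hd : DifferentiableOn ℂ (fun z => deriv F z / F z) (Metric.ball 0 1) :=
    (hF.deriv Metric.isOpen_ball).div hF h0
  obtain ⟨L, hL⟩ := hd.isExactOn_ball
  have h00 : (0 : ℂ) ∈ Metric.ball (0 : ℂ) 1 := by simp
  refine ⟨fun z => L z - L 0 + Complex.log (F 0), fun z hz =>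
    ((hL z hz).differentiableAt.sub_const _ |>.add_const _).differentiableWithinAt, fun z hz => ?_⟩
  -- `F e^{-L}` has zero derivative
  have hder : ∀ w ∈ Metric.ball (0 : ℂ) 1,
      HasDerivAt (fun w => F w * Complex.exp (-L w)) 0 w := fun w hw => by
    have h1 := (hF.differentiableAt (Metric.isOpen_ball.mem_nhds hw)).hasDerivAt
    convert! h1.mul (hL w hw).neg.cexp using 1
    field_simp [h0 w hw]
    ring
  have hconst := Metric.isOpen_ball.is_const_of_deriv_eq_zero
    (convex_ball (0 : ℂ) 1).isPreconnected
    (fun w hw => (hder w hw).differentiableAt.differentiableWithinAt)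
    (fun w hw => (hder w hw).deriv) hz h00
  simp only [Complex.exp_neg] at hconst
  rw [Complex.exp_add, Complex.exp_log (h0 0 h00), Complex.exp_sub]
  field_simp at hconst ⊢
  rw [hconst, mul_comm]

/-- A holomorphic branch `g` of `Q ^ (p / 2)`: it turns the `p`-th power means of `Q` into quadratic
means of `g`. -/
theorem Polynomial.exists_analytic_rpow {Q : ℂ[X]}
    (h0 : ∀ z ∈ Metric.ball (0 : ℂ) 1, Q.eval z ≠ 0) (p : ℝ) :
    ∃ (B : PowerSeries ℂ) (g : ℂ → ℂ), HasSumOnDisc B g ∧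
      ∀ z ∈ Metric.ball (0 : ℂ) 1, ‖g z‖ₑ ^ (2 : ℝ) = ‖Q.eval z‖ₑ ^ p := by
  obtain ⟨H, hH, hexp⟩ := exists_exp_eq_of_differentiableOn Q.differentiable.differentiableOn h0
  have hg : DifferentiableOn ℂ (fun z => Complex.exp ((p / 2 : ℝ) * H z)) (Metric.ball 0 1) :=
    (hH.const_mul _).cexp
  obtain ⟨B, hB⟩ := hg.exists_hasSumOnDisc
  refine ⟨B, _, hB, fun z hz => ?_⟩
  rw [← hexp z hz, ← ofReal_norm, ← ofReal_norm, Complex.norm_exp, Complex.norm_exp,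
    ENNReal.ofReal_rpow_of_pos (Real.exp_pos _), ENNReal.ofReal_rpow_of_pos (Real.exp_pos _),
    ← Real.exp_mul, ← Real.exp_mul, Complex.re_ofReal_mul]
  congr 2
  ring

/-- Carleman's inequality for a zero-free polynomial `Q` and an integer weight: for the branch `g` of
`Q ^ (p / 2)`, the left side is `∑ |coeff n (g ^ (m + 1))|² / c_{m + 1}(n)`, and the integral on the
right bounds the square of the `H²` norm of `g`. -/
theorem Polynomial.bergmanIntegral_le_of_ne_zero {Q : ℂ[X]}
    (h0 : ∀ z ∈ Metric.ball (0 : ℂ) 1, Q.eval z ≠ 0) {p : ℝ} (hp : 0 < p) {m : ℕ} (hm : 0 < m) :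
    ENNReal.ofReal m * bergmanIntegral (m + 1) (p * (m + 1)) (fun z => Q.eval z) ≤
      (∫⁻ θ, ‖Q.eval (circleMap 0 1 θ)‖ₑ ^ p ∂circleMeasure) ^ (m + 1) := by
  obtain ⟨B, g, hB, hg⟩ := Q.exists_analytic_rpow h0 p
  have hmem : ∀ r : ℝ, 0 ≤ r → r < 1 → ∀ θ, circleMap 0 r θ ∈ Metric.ball (0 : ℂ) 1 :=
    fun r hr0 hr1 θ => by rwa [mem_ball_zero_iff, norm_circleMap_zero_of_nonneg hr0]
  have hsum : ∑' n, ‖B.coeff n‖ₑ ^ 2 ≤ ∫⁻ θ, ‖Q.eval (circleMap 0 1 θ)‖ₑ ^ p ∂circleMeasure := by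
    have hcont : Continuous fun x : ℝ × ℝ => Q.eval (circleMap 0 x.1 x.2) := by
      refine Q.continuous.comp ?_
      unfold circleMap
      fun_prop
    obtain ⟨M, hM⟩ := (isCompact_closedBall (0 : ℂ) 1).exists_bound_of_continuousOn
      Q.continuous.continuousOn
    refine ENNReal.tsum_le_of_tendsto_dilations
      (X := fun r => ∫⁻ θ, ‖Q.eval (circleMap 0 r θ)‖ₑ ^ p ∂circleMeasure) (by simp) ?_ ?_
    · refine tendsto_lintegral_enorm_rpow (M := M) hp ?_ ?_ fun θ => ?_
      · exact Eventually.of_forall fun r => Q.continuous.comp (continuous_circleMap 0 r)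
      · filter_upwards [Ioo_mem_nhdsLT (one_pos : (0 : ℝ) < 1)] with r hr θ
        exact hM _ (Metric.ball_subset_closedBall (hmem r hr.1.le hr.2 θ))
      · exact ((hcont.comp (Continuous.prodMk_left θ)).tendsto 1).mono_left nhdsWithin_le_nhds
    · intro r hr
      rw [← hB.lintegral_enorm_sq hr.1.le hr.2]
      refine le_of_eq (lintegral_congr fun θ => ?_)
      rw [← hg _ (hmem r hr.1.le hr.2 θ), ENNReal.rpow_two]
  have hI : bergmanIntegral (m + 1) (p * (m + 1)) (fun z => Q.eval z) =
      bergmanIntegral (m + 1) 2 (fun z => g z ^ (m + 1)) := by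
    refine setLIntegral_congr_fun measurableSet_Ioo fun t ht => ?_
    simp only
    congr 1
    refine lintegral_congr fun θ => ?_
    have hz := hmem (√t) (Real.sqrt_nonneg t) (by rw [Real.sqrt_lt' one_pos]; simpa using ht.2) θ
    rw [ENNReal.rpow_mul, ← hg _ hz, enorm_pow, ← ENNReal.rpow_natCast, ← ENNReal.rpow_mul,
      ← ENNReal.rpow_mul, mul_comm]
    push_cast
    rfl
  have hb := (hB.pow (m + 1)).bergmanIntegral_two (α := ((m + 1 : ℕ) : ℝ)) (by
    exact_mod_cast Nat.succ_lt_succ hm)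
  simp_rw [binomCoeff_natCast, ENNReal.ofReal_natCast] at hb
  push_cast at hb
  rw [add_sub_cancel_right] at hb
  rw [hI, hb]
  refine le_trans ?_ (pow_le_pow_left' hsum (m + 1))
  exact tsum_enorm_sq_coeff_pow_le B m

/-! ### Interpolation between consecutive integers -/

theorem bergmanIntegral_eq_lintegral_prod (β q : ℝ) {F : ℂ → ℂ} (hF : Continuous F) :
    bergmanIntegral β q F = ∫⁻ x, ENNReal.ofReal ((1 - x.1) ^ (β - 2)) *
      ‖F (circleMap 0 (√x.1) x.2)‖ₑ ^ q
        ∂((volume.restrict (Set.Ioo (0 : ℝ) 1)).prod circleMeasure) := by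
  have hc : Continuous fun x : ℝ × ℝ => F (circleMap 0 (√x.1) x.2) := by
    refine hF.comp ?_
    unfold circleMap
    fun_prop
  rw [lintegral_prod _ (by fun_prop), bergmanIntegral]
  refine lintegral_congr fun t => ?_
  exact (lintegral_const_mul' _ _ ENNReal.ofReal_ne_top).symm

/-- Hölder's inequality for the weighted area integrals. -/
theorem bergmanIntegral_interpolate {β₀ β₁ q₀ q₁ s : ℝ} (hq₀ : 0 ≤ q₀) (hq₁ : 0 ≤ q₁)
    (hs0 : 0 ≤ s) (hs1 : s ≤ 1) {F : ℂ → ℂ} (hF : Continuous F) :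
    bergmanIntegral ((1 - s) * β₀ + s * β₁) ((1 - s) * q₀ + s * q₁) F ≤
      bergmanIntegral β₀ q₀ F ^ (1 - s) * bergmanIntegral β₁ q₁ F ^ s := by
  have hc : Continuous fun x : ℝ × ℝ => F (circleMap 0 (√x.1) x.2) := by
    refine hF.comp ?_
    unfold circleMap
    fun_prop
  have hs1' : 0 ≤ 1 - s := by linarith
  simp_rw [bergmanIntegral_eq_lintegral_prod _ _ hF]
  refine le_trans (le_of_eq ?_) (ENNReal.lintegral_mul_norm_pow_le
    (by fun_prop) (by fun_prop) hs1' hs0 (by ring))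
  have hae : ∀ᵐ x : ℝ × ℝ ∂((volume.restrict (Set.Ioo (0 : ℝ) 1)).prod circleMeasure),
      x.1 ∈ Set.Ioo (0 : ℝ) 1 :=
    Measure.quasiMeasurePreserving_fst.ae (ae_restrict_mem measurableSet_Ioo)
  refine lintegral_congr_ae ?_
  filter_upwards [hae] with x hx
  have hx1 : 0 < 1 - x.1 := by linarith [hx.2]
  rw [ENNReal.mul_rpow_of_nonneg _ _ hs1', ENNReal.mul_rpow_of_nonneg _ _ hs0,
    ENNReal.ofReal_rpow_of_pos (by positivity), ENNReal.ofReal_rpow_of_pos (by positivity),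
    mul_mul_mul_comm, ← ENNReal.ofReal_mul (by positivity), ← ENNReal.rpow_mul,
    ← ENNReal.rpow_mul, ← ENNReal.rpow_add_of_nonneg _ _ (by positivity) (by positivity),
    ← Real.rpow_mul hx1.le, ← Real.rpow_mul hx1.le, ← Real.rpow_add hx1]
  congr 3 <;> ring

/-- The loss in interpolating between `m + 1` and `m + 2` is largest for `m = 1`, where it is
`(1 + s) / 2 ^ s`, with maximum at `1 + s = 1 / log 2`. -/
theorem interpolation_const_le {m s : ℝ} (hm : 1 ≤ m) (hs0 : 0 ≤ s) (hs1 : s ≤ 1) :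
    (m + s) * ((1 / m) ^ (1 - s) * (1 / (m + 1)) ^ s) ≤ 2 / (Real.exp 1 * Real.log 2) := by
  have hm0 : 0 < m := by linarith
  have hlog : 0 < Real.log 2 := Real.log_pos (by norm_num)
  have h2s : (0 : ℝ) < 2 ^ s := by positivity
  have e1 : (m + s) * ((1 / m) ^ (1 - s) * (1 / (m + 1)) ^ s) * 2 ^ s =
      (m + s) / m * (1 + (m - 1) / (m + 1)) ^ s := by
    have : (1 : ℝ) + (m - 1) / (m + 1) = (1 / m)⁻¹ * (1 / (m + 1)) * 2 := by
      field_simp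
      ring
    rw [this, Real.mul_rpow (by positivity) (by norm_num), Real.mul_rpow (by positivity)
      (by positivity), Real.inv_rpow (by positivity), Real.rpow_sub (by positivity), Real.rpow_one]
    ring
  -- Bernoulli's inequality for exponents in `[0, 1]`
  have e2 : (1 + (m - 1) / (m + 1)) ^ s ≤ 1 + s * ((m - 1) / (m + 1)) :=
    rpow_one_add_le_one_add_mul_self (by
      have : 0 ≤ (m - 1) / (m + 1) := div_nonneg (by linarith) (by linarith)
      linarith) hs0 hs1
  have e3 : (m + s) / m * (1 + s * ((m - 1) / (m + 1))) ≤ 1 + s := by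
    rw [div_mul_eq_mul_div, div_le_iff₀ hm0,
      show (m + s) * (1 + s * ((m - 1) / (m + 1))) =
        (m + s) * (m + 1 + s * (m - 1)) / (m + 1) by field_simp, div_le_iff₀ (by linarith)]
    nlinarith [mul_nonneg (mul_nonneg hs0 (by linarith : 0 ≤ 1 - s)) (by linarith : 0 ≤ m - 1)]
  have e4 : (m + s) * ((1 / m) ^ (1 - s) * (1 / (m + 1)) ^ s) * 2 ^ s ≤ 1 + s := by
    rw [e1]
    exact (mul_le_mul_of_nonneg_left e2 (by positivity)).trans e3
  have e5 : 1 + s ≤ 2 / (Real.exp 1 * Real.log 2) * 2 ^ s := by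
    have h := Real.add_one_le_exp ((1 + s) * Real.log 2 - 1)
    have h' : Real.exp ((1 + s) * Real.log 2 - 1) = 2 * 2 ^ s / Real.exp 1 := by
      rw [Real.exp_sub, add_mul, one_mul, Real.exp_add, Real.exp_log (by norm_num),
        Real.rpow_def_of_pos (by norm_num), mul_comm s]
    rw [h'] at h
    have h'' : (1 + s) * Real.log 2 ≤ 2 * 2 ^ s / Real.exp 1 := by linarith
    rw [← le_div_iff₀ hlog] at h''
    refine h''.trans_eq ?_
    field_simp
  exact le_of_mul_le_mul_right (e4.trans e5) h2s

theorem ENNReal.le_ofReal_one_div_mul {m : ℝ} (hm : 0 < m) {x y : ℝ≥0∞}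
    (h : ENNReal.ofReal m * x ≤ y) : x ≤ ENNReal.ofReal (1 / m) * y := by
  refine le_trans (le_of_eq ?_) (mul_le_mul_right h _)
  rw [← mul_assoc, ← ENNReal.ofReal_mul (by positivity), one_div_mul_cancel hm.ne',
    ENNReal.ofReal_one, one_mul]

/-- The inequality for zero-free polynomials, by Hölder interpolation of the area integral at `α`
between the integers `⌊α⌋` and `⌊α⌋ + 1`. -/
theorem Polynomial.bergmanIntegral_two_le_of_ne_zero {Q : ℂ[X]}
    (h0 : ∀ z ∈ Metric.ball (0 : ℂ) 1, Q.eval z ≠ 0) {α : ℝ} (hα : 2 < α) :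
    ENNReal.ofReal (α - 1) * bergmanIntegral α 2 (fun z => Q.eval z) ≤
      ENNReal.ofReal (2 / (Real.exp 1 * Real.log 2)) *
        (∫⁻ θ, ‖Q.eval (circleMap 0 1 θ)‖ₑ ^ (2 / α) ∂circleMeasure) ^ α := by
  have hp : 0 < 2 / α := by positivity
  obtain ⟨m, hm⟩ : ∃ m : ℕ, ⌊α⌋₊ = m + 1 :=
    Nat.exists_eq_succ_of_ne_zero (Nat.floor_pos.mpr (by linarith)).ne'
  have hm1 : 1 ≤ m := by
    have : 2 ≤ ⌊α⌋₊ := Nat.le_floor (by exact_mod_cast hα.le)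
    omega
  have hm1' : (1 : ℝ) ≤ m := by exact_mod_cast hm1
  have hf1 := Nat.floor_le (by linarith : 0 ≤ α)
  have hf2 := Nat.lt_floor_add_one α
  rw [hm] at hf1 hf2
  push_cast at hf1 hf2
  obtain ⟨s, hs⟩ : ∃ s, s = α - (m + 1) := ⟨_, rfl⟩
  have hs0 : 0 ≤ s := by linarith
  have hs1 : s ≤ 1 := by linarith
  have hs1' : 0 ≤ 1 - s := by linarith
  have hαs : α = m + 1 + s := by linarith
  set A := ∫⁻ θ, ‖Q.eval (circleMap 0 1 θ)‖ₑ ^ (2 / α) ∂circleMeasure with hA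
  have i0 := ENNReal.le_ofReal_one_div_mul (by positivity)
    (Q.bergmanIntegral_le_of_ne_zero h0 hp hm1)
  have i1 := Q.bergmanIntegral_le_of_ne_zero h0 hp (Nat.succ_pos m)
  push_cast at i1
  replace i1 := ENNReal.le_ofReal_one_div_mul (by positivity) i1
  rw [← hA, ← ENNReal.rpow_natCast] at i0 i1
  push_cast at i0 i1
  have hint := bergmanIntegral_interpolate (β₀ := m + 1) (β₁ := m + 1 + 1)
    (q₀ := 2 / α * (m + 1)) (q₁ := 2 / α * (m + 1 + 1)) (by positivity) (by positivity) hs0 hs1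
    Q.continuous
  have hβ : (1 - s) * ((m : ℝ) + 1) + s * (m + 1 + 1) = α := by rw [hαs]; ring
  have hq : (1 - s) * (2 / α * ((m : ℝ) + 1)) + s * (2 / α * (m + 1 + 1)) = 2 := by
    calc _ = 2 / α * ((1 - s) * ((m : ℝ) + 1) + s * (m + 1 + 1)) := by ring
      _ = 2 := by rw [hβ]; field_simp
  rw [hβ, hq] at hint
  calc _ ≤ ENNReal.ofReal (α - 1) *
        ((ENNReal.ofReal (1 / m) * A ^ ((m : ℝ) + 1)) ^ (1 - s) *
          (ENNReal.ofReal (1 / (m + 1)) * A ^ ((m : ℝ) + 1 + 1)) ^ s) := by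
        gcongr
        exact hint.trans (mul_le_mul' (ENNReal.rpow_le_rpow i0 hs1') (ENNReal.rpow_le_rpow i1 hs0))
    _ = ENNReal.ofReal ((m + s) * ((1 / m) ^ (1 - s) * (1 / (m + 1)) ^ s)) * A ^ α := by
        rw [ENNReal.mul_rpow_of_nonneg _ _ hs1', ENNReal.mul_rpow_of_nonneg _ _ hs0,
          ENNReal.ofReal_rpow_of_pos (by positivity), ENNReal.ofReal_rpow_of_pos (by positivity),
          mul_mul_mul_comm, ← ENNReal.ofReal_mul (by positivity), ← ENNReal.rpow_mul,
          ← ENNReal.rpow_mul, ← ENNReal.rpow_add_of_nonneg _ _ (by positivity) (by positivity),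
          ← mul_assoc, ← ENNReal.ofReal_mul (by linarith)]
        congr 3
        · rw [hαs]; ring
        · rw [← hβ]; ring
    _ ≤ _ := by
        gcongr
        exact interpolation_const_le hm1' hs0 hs1

theorem Polynomial.tsum_enorm_sq_coeff_le (P : ℂ[X]) {α : ℝ} (hα : 2 < α) :
    ∑' n, ‖P.coeff n‖ₑ ^ 2 / ENNReal.ofReal (binomCoeff α n) ≤
      ENNReal.ofReal (2 / (Real.exp 1 * Real.log 2)) *
        (∫⁻ θ, ‖P.eval (circleMap 0 1 θ)‖ₑ ^ (2 / α) ∂circleMeasure) ^ α := by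
  rcases eq_or_ne P 0 with rfl | hP
  · simp
  obtain ⟨Q, h0, hle, heq⟩ := P.exists_reflect_roots hP
  have hsum : HasSumOnDisc (P : PowerSeries ℂ) (fun z => P.eval z) := fun z _ => by
    simp_rw [Polynomial.coeff_coe]
    rw [Polynomial.eval_eq_sum_range]
    refine hasSum_sum_of_ne_finset_zero fun n hn => ?_
    rw [Polynomial.coeff_eq_zero_of_natDegree_lt (by simpa using hn), zero_mul]
  have h1 := hsum.bergmanIntegral_two (α := α) (by linarith)
  simp_rw [Polynomial.coeff_coe] at h1
  have h2 : ∀ θ, ‖P.eval (circleMap 0 1 θ)‖ₑ = ‖Q.eval (circleMap 0 1 θ)‖ₑ := fun θ => by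
    rw [← ofReal_norm, ← ofReal_norm, heq _ (by simp)]
  simp_rw [h2]
  rw [← h1]
  refine le_trans ?_ (Q.bergmanIntegral_two_le_of_ne_zero h0 hα)
  gcongr
  exact bergmanIntegral_mono (by norm_num) hle

/-! ### Passage to the Hardy space -/

theorem lintegral_circleMap_rpow_le_hardyNorm {p : ℝ} (f : ℂ → ℂ) {r : ℝ}
    (hr : r ∈ Set.Ioo (0 : ℝ) 1) :
    (∫⁻ θ, ‖f (circleMap 0 r θ)‖ₑ ^ p ∂circleMeasure) ^ (1 / p) ≤ hardyNorm p f := by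
  rw [lintegral_circleMeasure]
  simp only [circleMap, zero_add]
  exact le_iSup₂ (f := fun (r : ℝ) (_ : r ∈ Set.Ioo (0 : ℝ) 1) =>
    ((∫⁻ θ in Set.Ioc (0 : ℝ) (2 * Real.pi),
        ‖f ((r : ℂ) * Complex.exp ((θ : ℂ) * Complex.I))‖ₑ ^ p) /
      ENNReal.ofReal (2 * Real.pi)) ^ (1 / p)) r hr

theorem HasSumOnDisc.tsum_enorm_sq_coeff_le_hardyNorm {B : PowerSeries ℂ} {f : ℂ → ℂ}
    (h : HasSumOnDisc B f) {p : ℝ} (hp0 : 0 < p) (hp1 : p < 1) :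
    ∑' n, ‖B.coeff n‖ₑ ^ 2 / ENNReal.ofReal (binomCoeff (2 / p) n) ≤
      ENNReal.ofReal (2 / (Real.exp 1 * Real.log 2)) * hardyNorm p f ^ 2 := by
  have hα : 2 < 2 / p := by rw [lt_div_iff₀ hp0]; linarith
  have hc := binomCoeff_pos (by linarith : 0 < 2 / p)
  refine ENNReal.tsum_le_of_tendsto_dilations (fun n => ENNReal.div_ne_top (by simp)
    (by simpa using hc n)) tendsto_const_nhds fun r hr => ?_
  refine ENNReal.tsum_le_of_sum_range_le fun M => ?_
  -- the dilation `z ↦ f (r z)` is a uniform limit of its Taylor polynomials on the closed disc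
  have hlim := h.tendsto_lintegral_dilatedTrunc hr.1.le hr.2 hp0
  have hlim' := ENNReal.Tendsto.const_mul
    ((ENNReal.continuous_rpow_const (y := 2 / p)).tendsto _ |>.comp hlim)
    (Or.inr (ENNReal.ofReal_ne_top (r := 2 / (Real.exp 1 * Real.log 2))))
  refine le_trans (ge_of_tendsto hlim' ?_) ?_
  · filter_upwards [eventually_ge_atTop M] with N hN
    have hP := (dilatedTrunc B r N).tsum_enorm_sq_coeff_le hα
    rw [show 2 / (2 / p) = p by field_simp] at hP
    refine le_trans ?_ hP
    refine le_trans (le_of_eq ?_) (ENNReal.sum_le_tsum (Finset.range M))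
    refine Finset.sum_congr rfl fun n hn => ?_
    rw [coeff_dilatedTrunc, if_pos ((Finset.mem_range.mp hn).trans_le hN), enorm_mul, enorm_pow,
      mul_pow, ← pow_mul, mul_comm n 2, pow_mul, mul_div_assoc, mul_comm, ← ofReal_norm (r : ℂ),
      Complex.norm_real, Real.norm_of_nonneg hr.1.le, ENNReal.ofReal_pow hr.1.le]
  · gcongr
    rw [← ENNReal.rpow_two, show (2 : ℝ) / p = 1 / p * 2 by ring, ENNReal.rpow_mul]
    gcongr
    exact lintegral_circleMap_rpow_le_hardyNorm f hr

theorem two_div_exp_mul_log_bounds :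
    (1.030279 : ℝ) < (2 / (Real.exp 1 * Real.log 2)) ^ (1 / 2 : ℝ) ∧
    (2 / (Real.exp 1 * Real.log 2)) ^ (1 / 2 : ℝ) < (1.030280 : ℝ) := by
  have e1 := Real.exp_one_gt_d9
  have e2 := Real.exp_one_lt_d9
  have l1 := Real.log_two_gt_d9
  have l2 := Real.log_two_lt_d9
  have hpos : 0 < Real.exp 1 * Real.log 2 := by positivity
  have hu : Real.exp 1 * Real.log 2 < 2.7182818286 * 0.6931471808 := by gcongr
  have hl : 2.7182818283 * 0.6931471803 < Real.exp 1 * Real.log 2 := by gcongr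
  rw [← Real.sqrt_eq_rpow]
  constructor
  · rw [Real.lt_sqrt (by norm_num), lt_div_iff₀ hpos]
    linarith
  · rw [Real.sqrt_lt' (by norm_num), div_lt_iff₀ hpos]
    linarith

theorem theorem2p5 :
    (∀ (p : ℝ), 0 < p → p < 1 →
      ∀ (f : ℂ → ℂ) (a : ℕ → ℂ), MemHardy p f →
        (∀ z ∈ Metric.ball (0 : ℂ) 1, HasSum (fun n : ℕ => a n * z ^ n) (f z)) →
        Summable (fun n : ℕ => ‖a n‖ ^ 2 / binomCoeff (2 / p) n) ∧
          (∑' n : ℕ, ‖a n‖ ^ 2 / binomCoeff (2 / p) n) ^ (1 / 2 : ℝ) ≤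
            (2 / (Real.exp 1 * Real.log 2)) ^ (1 / 2 : ℝ) * (hardyNorm p f).toReal) ∧
    (1.030279 : ℝ) < (2 / (Real.exp 1 * Real.log 2)) ^ (1 / 2 : ℝ) ∧
    (2 / (Real.exp 1 * Real.log 2)) ^ (1 / 2 : ℝ) < (1.030280 : ℝ) := by
  refine ⟨fun p hp0 hp1 f a hf ha => ?_, two_div_exp_mul_log_bounds⟩
  have hB : HasSumOnDisc (PowerSeries.mk a) f := fun z hz => by simpa using ha z hz
  have hmain := hB.tsum_enorm_sq_coeff_le_hardyNorm hp0 hp1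
  simp only [PowerSeries.coeff_mk] at hmain
  have hc := binomCoeff_pos (by positivity : 0 < 2 / p)
  have htop : ENNReal.ofReal (2 / (Real.exp 1 * Real.log 2)) * hardyNorm p f ^ 2 ≠ ∞ :=
    ENNReal.mul_ne_top ENNReal.ofReal_ne_top (ENNReal.pow_ne_top hf.2.ne)
  have hreal : ∀ n, (‖a n‖ₑ ^ 2 / ENNReal.ofReal (binomCoeff (2 / p) n)).toReal =
      ‖a n‖ ^ 2 / binomCoeff (2 / p) n := fun n => by
    simp [ENNReal.toReal_div, ENNReal.toReal_ofReal (hc n).le]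
  have hfin := ne_top_of_le_ne_top htop hmain
  have hpos : 0 ≤ 2 / (Real.exp 1 * Real.log 2) := by positivity
  refine ⟨(ENNReal.summable_toReal hfin).congr hreal, ?_⟩
  have h := ENNReal.toReal_mono htop hmain
  rw [ENNReal.tsum_toReal_eq fun n => ENNReal.ne_top_of_tsum_ne_top hfin n, ENNReal.toReal_mul,
    ENNReal.toReal_ofReal hpos, ENNReal.toReal_pow] at h
  simp_rw [hreal] at h
  rw [← Real.sqrt_eq_rpow, ← Real.sqrt_eq_rpow]
  refine (Real.sqrt_le_sqrt h).trans_eq ?_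
  rw [Real.sqrt_mul hpos, Real.sqrt_sq ENNReal.toReal_nonneg]
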